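/- Let $\ell\ge 1$ be an integer and let $L_1,\dots,L_\ell$ be independent real random variables, each with the density $\rho(v)=\frac{\pi}{2}\,\mathrm{sech}^2(\pi v)$ on $\mathbb{R}$. For a real number $x$ put $$\mathrm{eval}\{\log \mathfrak{B}^{(\ell)}(x)\} := \mathbb{E}\Big[\log\Big(x-\frac{\ell}{2}+i\,(L_1+\cdots+L_\ell)\Big)\Big],$$ where $\log$ is the principal branch of the complex logarithm, and $$R_\ell(x) := -H_{\ell-1}+\frac{d^{\ell-1}}{dx^{\ell-1}}\left\{\binom{x-1}{\ell-1}\,\psi\Big(x-\Big\lfloor\frac{\ell}{2}\Big\rfloor\Big)\right\},$$ where $H_r=\sum_{k=1}^r \frac1k$ (so $H_0=0$), $\binom{a}{k}=\frac{a(a-1)\cdots(a-k+1)}{k!}$ and $\psi=\Gamma'/\Gamma$ is the digamma function. Then the expectation exists (the random variable is integrable) for every $x\in\mathbb{R}$, and for every $x\ge \ell/2$, $$\mathrm{eval}\{\log \mathfrak{B}^{(\ell)}(x)\} = R_\ell(x).$$ At $x=\ell/2$ the function $R_\ell$ has a limit equal to the left side; for odd $\ell$ the function is defined there and this is its value, while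 for even $\ell$ the function in braces has a removable singularity there and $R_\ell(\ell/2)$ denotes that limit. For real $x<\ell/2$ the formula holds with $x$ replaced by $\ell-x$ on the right: $$\mathrm{eval}\{\log \mathfrak{B}^{(\ell)}(x)\} = R_\ell(\ell-x).$$ -/

import Mathlib

open MeasureTheory ProbabilityTheory Filter Topology

noncomputable section

/-- The squared hyperbolic secant distribution on `ℝ`, with density
`v ↦ (π / 2) * sech (π v) ^ 2` with respect to Lebesgue measure. -/
def sechSqLaw : Measure ℝ :=
  volume.withDensity fun v => ENNReal.ofReal (Real.pi / 2 * (1 / Real.cosh (Real.pi * v)) ^ 2)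

/-- The complex random variable `x - ℓ/2 + i (L₁ + ⋯ + L_ℓ)` that realizes the umbra
`𝔅^(ℓ)(x)`. -/
def norlundUmbra {Ω : Type*} {ℓ : ℕ} (L : Fin ℓ → Ω → ℝ) (x : ℝ) (ω : Ω) : ℂ :=
  (x : ℂ) - (ℓ : ℂ) / 2 + Complex.I * ((∑ j, L j ω : ℝ) : ℂ)

/-- `eval {g (𝔅^(ℓ)(x))} = 𝔼 [g (x - ℓ/2 + i (L₁ + ⋯ + L_ℓ))]`. -/
def norlundEval {Ω : Type*} [MeasurableSpace Ω] (P : Measure Ω) {ℓ : ℕ} (L : Fin ℓ → Ω → ℝ)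
    (g : ℂ → ℂ) (x : ℝ) : ℂ :=
  ∫ ω, g (norlundUmbra L x ω) ∂P

/-- `-H_{ℓ-1} + d^{ℓ-1}/dx^{ℓ-1} {binom (x-1) (ℓ-1) * ψ (x - ⌊ℓ/2⌋)}`, for `ℓ ≥ 1`.
The natural number division `ℓ / 2` is `⌊ℓ/2⌋`, and `Ring.choose` is the binomial polynomial
`binom a k = a (a-1) ⋯ (a-k+1) / k!`. -/
def digammaExpr (ℓ : ℕ) (x : ℝ) : ℂ :=
  -((harmonic (ℓ - 1) : ℚ) : ℂ) +
    iteratedDeriv (ℓ - 1)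
      (fun y : ℝ => Ring.choose ((y : ℂ) - 1) (ℓ - 1) *
        Complex.digamma ((y : ℂ) - ((ℓ / 2 : ℕ) : ℂ))) x

end

noncomputable section

/-! Put `S = L₁ + ⋯ + L_ℓ`, `U_ℓ(a) = 𝔼 log (a + iS)`, and let `F_n` be `digammaCore n`, the right
side with `n = ℓ - 1` and the shift `⌊ℓ/2⌋` dropped. The shift is harmless: `ψ(x - j)` differs from
`ψ(x)` by simple fractions whose denominators divide `binom (x-1) n`, so inside the `n`-th
derivative it only changes a polynomial of degree below `n` (`exists_choose_mul_digamma_sub`).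

Both sides solve the same difference equation. One sech² variable has characteristic function `t /
(2 sinh (t/2))` (`charFun_sechSqLaw_mul_sinh`). The derivative `U_ℓ'(a) = 𝔼 1/(a + iS)` is a Laplace
transform of the `ℓ`-th power of it, and integrating over a window of length one multiplies by `2
sinh (t/2) / t`, which removes one factor: `U_{ℓ+1}(a + 1/2) - U_{ℓ+1}(a - 1/2) = U_ℓ'(a)`. Pascal's
rule and `ψ(x+1) = ψ(x) + 1/x` give `F_{n+1}(x+1) - F_{n+1}(x) = F_n'(x)`.

By induction the two sides differ by a 1-periodic function. It tends to `0` at infinity, the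
constant `-H_n` being exactly what this requires, so it vanishes for `x > ℓ/2`
(`logPotential_sechSqConvPow_succ`). The endpoint follows by continuity, since the law of `S` has
bounded density and `log` is integrable at `0`; the range `x < ℓ/2` follows from the symmetry of
`S`. -/

/-! ### Iterated derivatives, binomial polynomials, analyticity of digamma -/

lemma AnalyticAt.iteratedDeriv_real {f : ℝ → ℂ} {x : ℝ} (hf : AnalyticAt ℝ f x) (n : ℕ) :
    AnalyticAt ℝ (iteratedDeriv n f) x := by
  induction n with
  | zero => simpa using hf
  | succ n ih => rw [iteratedDeriv_succ]; exact ih.deriv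

lemma analyticAt_polynomial_ofReal (p : Polynomial ℂ) (x : ℝ) :
    AnalyticAt ℝ (fun y : ℝ => p.eval (y : ℂ)) x :=
  ((p.differentiable.analyticAt (x : ℂ)).restrictScalars (𝕜 := ℝ)).comp
    (Complex.ofRealCLM.analyticAt x)

lemma iteratedDeriv_polynomial_ofReal (p : Polynomial ℂ) (n : ℕ) :
    iteratedDeriv n (fun y : ℝ => p.eval (y : ℂ)) =
      fun y : ℝ => (Polynomial.derivative^[n] p).eval (y : ℂ) := by
  induction n with
  | zero => simp
  | succ n ih =>
    rw [iteratedDeriv_succ, ih]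
    ext y
    rw [Function.iterate_succ_apply']
    exact ((Polynomial.hasDerivAt _ (y : ℂ)).comp_ofReal).deriv

lemma iteratedDeriv_polynomial_ofReal_eq_zero {p : Polynomial ℂ} {n : ℕ} (h : p.degree < n)
    (x : ℝ) : iteratedDeriv n (fun y : ℝ => p.eval (y : ℂ)) x = 0 := by
  simp [iteratedDeriv_polynomial_ofReal, Polynomial.iterate_derivative_eq_zero_of_degree_lt h]

/-- The Leibniz rule stops after two terms because one factor is affine. -/
lemma iteratedDeriv_sub_const_mul {u : ℝ → ℂ} {x : ℝ} (hu : AnalyticAt ℝ u x) (c : ℂ) (n : ℕ) :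
    iteratedDeriv (n + 1) (fun y : ℝ => ((y : ℂ) - c) * u y) x =
      ((x : ℂ) - c) * iteratedDeriv (n + 1) u x + (n + 1) * iteratedDeriv n u x := by
  have hlin : ∀ y : ℝ, HasDerivAt (fun y : ℝ => (y : ℂ) - c) 1 y := fun y =>
    ((hasDerivAt_id (y : ℂ)).sub_const c).comp_ofReal
  induction n generalizing x with
  | zero =>
    simp only [zero_add, iteratedDeriv_one, iteratedDeriv_zero, Nat.cast_zero]
    rw [((hlin x).fun_mul hu.differentiableAt.hasDerivAt).deriv]
    ring
  | succ n ih =>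
    have hev : iteratedDeriv (n + 1) (fun y : ℝ => ((y : ℂ) - c) * u y) =ᶠ[𝓝 x]
        fun x => ((x : ℂ) - c) * iteratedDeriv (n + 1) u x + (n + 1) * iteratedDeriv n u x := by
      filter_upwards [hu.eventually_analyticAt] with y hy using ih hy
    have hd := fun k => (hu.iteratedDeriv_real k).differentiableAt.hasDerivAt
    rw [iteratedDeriv_succ, hev.deriv_eq,
      (((hlin x).fun_mul (hd (n + 1))).fun_add ((hd n).const_mul ((n : ℂ) + 1))).deriv,
      ← iteratedDeriv_succ, ← iteratedDeriv_succ]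
    push_cast
    ring

lemma complex_choose_eq_prod (a : ℂ) (n : ℕ) :
    Ring.choose a n = (n.factorial : ℂ)⁻¹ * ∏ i ∈ Finset.range n, (a - i) := by
  have h := Ring.descPochhammer_eq_factorial_smul_choose a n
  have h2 : (descPochhammer ℤ n).smeval a = ∏ i ∈ Finset.range n, (a - i) := by
    rw [← descPochhammer_eval_eq_prod_range]
    rw [← descPochhammer_map (Int.castRingHom ℂ) n, Polynomial.eval_map,
      ← Polynomial.eval₂_smulOneHom_eq_smeval]
    congr 1
    exact Subsingleton.elim _ _
  rw [← h2, h, nsmul_eq_mul, ← mul_assoc, inv_mul_cancel₀ (by exact_mod_cast n.factorial_ne_zero), one_mul]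

lemma complex_choose_succ (a : ℂ) (n : ℕ) :
    Ring.choose a (n + 1) = (a - n) / (n + 1) * Ring.choose a n := by
  rw [complex_choose_eq_prod, complex_choose_eq_prod, Finset.prod_range_succ, Nat.factorial_succ]
  have : (n.factorial : ℂ) ≠ 0 := by exact_mod_cast n.factorial_ne_zero
  have : (n + 1 : ℂ) ≠ 0 := n.cast_add_one_ne_zero
  push_cast
  field_simp

lemma Complex.ofReal_ne_neg_natCast {x : ℝ} (hx : 0 < x) (m : ℕ) : (x : ℂ) ≠ -m := by
  intro h
  have := congrArg Complex.re h
  simp only [Complex.ofReal_re, Complex.neg_re, Complex.natCast_re] at this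
  have : (0 : ℝ) ≤ m := m.cast_nonneg
  linarith

lemma analyticAt_digamma {z : ℂ} (hz : 0 < z.re) : AnalyticAt ℂ Complex.digamma z := by
  have hn : ∀ w : ℂ, 0 < w.re → ∀ m : ℕ, w ≠ -m := by
    intro w hw m h
    rw [h] at hw
    simp only [Complex.neg_re, Complex.natCast_re] at hw
    have : (0 : ℝ) ≤ m := m.cast_nonneg
    linarith
  have hG : AnalyticAt ℂ Complex.Gamma z :=
    DifferentiableOn.analyticAt (s := {w : ℂ | 0 < w.re})
      (fun w hw => (Complex.differentiableAt_Gamma w (hn w hw)).differentiableWithinAt)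
      ((isOpen_lt continuous_const Complex.continuous_re).mem_nhds hz)
  exact hG.deriv.div hG (Complex.Gamma_ne_zero (hn z hz))

lemma analyticAt_digamma_ofReal {x : ℝ} (hx : 0 < x) :
    AnalyticAt ℝ (fun y : ℝ => Complex.digamma (y : ℂ)) x :=
  ((analyticAt_digamma (z := (x : ℂ)) (by simpa using hx)).restrictScalars (𝕜 := ℝ)).comp
    (Complex.ofRealCLM.analyticAt x)

/-! ### The digamma side: recurrences and removal of the shift -/

/-- The polynomial `binom (X - 1) n`. -/
def chooseSubOnePoly (n : ℕ) : Polynomial ℂ :=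
  Polynomial.C (n.factorial : ℂ)⁻¹ * ∏ i ∈ Finset.range n, (Polynomial.X - Polynomial.C (1 + i : ℂ))

lemma eval_chooseSubOnePoly (n : ℕ) (a : ℂ) :
    (chooseSubOnePoly n).eval a = Ring.choose (a - 1) n := by
  simp [chooseSubOnePoly, complex_choose_eq_prod, Polynomial.eval_prod, sub_sub]

lemma natDegree_chooseSubOnePoly_le (n : ℕ) : (chooseSubOnePoly n).natDegree ≤ n := by
  refine (Polynomial.natDegree_C_mul_le _ _).trans ?_
  rw [Polynomial.natDegree_finsetProd_X_sub_C_eq_card]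
  simp

/-- The function `y ↦ binom (y - 1) n * ψ y`. -/
def chooseMulDigamma (n : ℕ) (y : ℝ) : ℂ :=
  Ring.choose ((y : ℂ) - 1) n * Complex.digamma (y : ℂ)

/-- The function `-H_n + d^n/dx^n {binom (x - 1) n * ψ x}`, which is regular for `x > 0`. -/
def digammaCore (n : ℕ) (x : ℝ) : ℂ :=
  -((harmonic n : ℚ) : ℂ) + iteratedDeriv n (chooseMulDigamma n) x

lemma analyticAt_chooseMulDigamma (n : ℕ) {x : ℝ} (hx : 0 < x) :
    AnalyticAt ℝ (chooseMulDigamma n) x := by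
  have h := (analyticAt_polynomial_ofReal (chooseSubOnePoly n) x).mul
    (analyticAt_digamma_ofReal hx)
  simp only [eval_chooseSubOnePoly] at h
  exact h

lemma analyticAt_digammaCore (n : ℕ) {x : ℝ} (hx : 0 < x) : AnalyticAt ℝ (digammaCore n) x :=
  analyticAt_const.add ((analyticAt_chooseMulDigamma n hx).iteratedDeriv_real n)

lemma deriv_digammaCore (n : ℕ) (x : ℝ) :
    deriv (digammaCore n) x = iteratedDeriv (n + 1) (chooseMulDigamma n) x := by
  rw [iteratedDeriv_succ]
  exact deriv_const_add _

/-- Passing from `n` to `n + 1` multiplies the binomial by the affine factor `(x - (n+1)) / (n+1)`,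
and the harmonic number contributes `-1/(n+1)`. This carries the asymptotics at infinity through the
induction. -/
lemma digammaCore_succ (n : ℕ) {x : ℝ} (hx : 0 < x) :
    digammaCore (n + 1) x =
      digammaCore n x + ((x : ℂ) - (n + 1)) / (n + 1) * deriv (digammaCore n) x - 1 / (n + 1) := by
  have hn : (n + 1 : ℂ) ≠ 0 := n.cast_add_one_ne_zero
  have hu : chooseMulDigamma (n + 1) =
      fun y : ℝ => (n + 1 : ℂ)⁻¹ * (((y : ℂ) - (n + 1)) * chooseMulDigamma n y) := by
    ext y
    simp only [chooseMulDigamma, complex_choose_succ]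
    field_simp
    ring
  have ha : AnalyticAt ℝ (fun y : ℝ => ((y : ℂ) - (n + 1)) * chooseMulDigamma n y) x :=
    ((Complex.ofRealCLM.analyticAt x).sub analyticAt_const).mul (analyticAt_chooseMulDigamma n hx)
  rw [deriv_digammaCore, digammaCore, hu, iteratedDeriv_const_mul _ ha.contDiffAt,
    iteratedDeriv_sub_const_mul (analyticAt_chooseMulDigamma n hx), digammaCore, harmonic_succ]
  push_cast
  field_simp
  ring

lemma digammaCore_zero (x : ℝ) : digammaCore 0 x = Complex.digamma (x : ℂ) := by
  simp [digammaCore, chooseMulDigamma]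

/-- Pascal's rule splits the binomial; the `1/x` from `ψ(x+1)` meets `binom x (n+1)`, which is
divisible by `x`, and leaves a polynomial of degree at most `n`. -/
lemma chooseMulDigamma_succ_add_one (n : ℕ) {x : ℝ} (hx : 0 < x) :
    chooseMulDigamma (n + 1) (x + 1) = chooseMulDigamma (n + 1) x + chooseMulDigamma n x +
      (Polynomial.C (n + 1 : ℂ)⁻¹ * chooseSubOnePoly n).eval (x : ℂ) := by
  have hx0 : (x : ℂ) ≠ 0 := by exact_mod_cast hx.ne'
  have hn : (n + 1 : ℂ) ≠ 0 := n.cast_add_one_ne_zero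
  have h1 : Ring.choose (x : ℂ) (n + 1) =
      Ring.choose ((x : ℂ) - 1) (n + 1) + Ring.choose ((x : ℂ) - 1) n := by
    have := Ring.choose_succ_succ ((x : ℂ) - 1) n
    rw [sub_add_cancel] at this
    rw [this, add_comm]
  have h2 : Ring.choose (x : ℂ) (n + 1) * (x : ℂ)⁻¹ =
      (n + 1 : ℂ)⁻¹ * Ring.choose ((x : ℂ) - 1) n := by
    rw [h1, complex_choose_succ]
    field_simp
    ring
  simp only [chooseMulDigamma, Complex.ofReal_add, Complex.ofReal_one, add_sub_cancel_right]
  rw [Complex.digamma_apply_add_one _ (Complex.ofReal_ne_neg_natCast hx), mul_add, h2, h1,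
    Polynomial.eval_mul, Polynomial.eval_C, eval_chooseSubOnePoly]
  ring

/-- The `n + 1` derivatives kill the polynomial remainder, and the harmonic constants cancel. -/
lemma digammaCore_succ_add_one (n : ℕ) {x : ℝ} (hx : 0 < x) :
    digammaCore (n + 1) (x + 1) = digammaCore (n + 1) x + deriv (digammaCore n) x := by
  set p : Polynomial ℂ := Polynomial.C (n + 1 : ℂ)⁻¹ * chooseSubOnePoly n
  have hdeg : p.degree < (n + 1 : ℕ) := Polynomial.degree_le_natDegree.trans_lt <| by
    exact_mod_cast Nat.lt_succ_of_le
      ((Polynomial.natDegree_C_mul_le _ _).trans (natDegree_chooseSubOnePoly_le n))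
  have hev : (fun y : ℝ => chooseMulDigamma (n + 1) (y + 1)) =ᶠ[𝓝 x]
      fun y => chooseMulDigamma (n + 1) y + chooseMulDigamma n y + p.eval (y : ℂ) := by
    filter_upwards [eventually_gt_nhds hx] with y hy using chooseMulDigamma_succ_add_one n hy
  have h := hev.iteratedDeriv_eq (n + 1)
  have h1 := analyticAt_chooseMulDigamma (n + 1) hx
  have h2 := analyticAt_chooseMulDigamma n hx
  have h3 := analyticAt_polynomial_ofReal p x
  rw [iteratedDeriv_comp_add_const, iteratedDeriv_fun_add (h1.fun_add h2).contDiffAt h3.contDiffAt,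
    iteratedDeriv_polynomial_ofReal_eq_zero hdeg, add_zero,
    iteratedDeriv_fun_add h1.contDiffAt h2.contDiffAt] at h
  beta_reduce at h
  rw [deriv_digammaCore, digammaCore, digammaCore, h]
  ring

/-- Each unit shift costs `1 / (y - (j+1))`, and this denominator is a factor of `binom (y-1) n` as
long as `j < n`. The excluded points are those where `y - j` is a pole of `ψ`. -/
lemma exists_choose_mul_digamma_sub (n j : ℕ) (hj : j ≤ n) :
    ∃ p : Polynomial ℂ, p.degree < n ∧ ∀ y : ℝ, 0 < y → (∀ i < j, y ≠ i + 1) →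
      Ring.choose ((y : ℂ) - 1) n * Complex.digamma ((y : ℂ) - j) =
        chooseMulDigamma n y - p.eval (y : ℂ) := by
  induction j with
  | zero => exact ⟨0, by simp, by simp [chooseMulDigamma]⟩
  | succ j ih =>
    obtain ⟨p, hp, hpy⟩ := ih (by omega)
    set q : Polynomial ℂ := Polynomial.C (n.factorial : ℂ)⁻¹ *
      ∏ i ∈ (Finset.range n).erase j, (Polynomial.X - Polynomial.C (1 + i : ℂ)) with hq
    have hqd : q.degree < n := by
      refine Polynomial.degree_le_natDegree.trans_lt ?_
      have : q.natDegree ≤ n - 1 := by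
        refine (Polynomial.natDegree_C_mul_le _ _).trans ?_
        rw [Polynomial.natDegree_finsetProd_X_sub_C_eq_card,
          Finset.card_erase_of_mem (Finset.mem_range.2 (by omega)), Finset.card_range]
      exact_mod_cast this.trans_lt (by omega)
    refine ⟨p + q, (Polynomial.degree_add_le _ _).trans_lt (max_lt hp hqd), fun y hy hyj => ?_⟩
    have hne : (y : ℂ) - (j + 1) ≠ 0 := by
      rw [sub_ne_zero]
      exact_mod_cast hyj j (by omega)
    have hpole : ∀ m : ℕ, (y : ℂ) - (j + 1) ≠ -m := by
      intro m hm
      have hm' : y - (j + 1) = -m := by exact_mod_cast hm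
      rcases le_or_gt m j with h | h
      · refine hyj (j - m) (by omega) ?_
        rw [Nat.cast_sub h]
        linarith
      · have : (j : ℝ) + 1 ≤ m := by exact_mod_cast h
        linarith
    have hdig := Complex.digamma_apply_add_one _ hpole
    rw [show (y : ℂ) - (j + 1) + 1 = y - j by ring] at hdig
    have hqy : q.eval (y : ℂ) = Ring.choose ((y : ℂ) - 1) n * ((y : ℂ) - (j + 1))⁻¹ := by
      rw [complex_choose_eq_prod,
        ← Finset.mul_prod_erase _ _ (Finset.mem_range.2 (by omega : j < n)), hq]
      simp only [Polynomial.eval_mul, Polynomial.eval_C, Polynomial.eval_prod,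
        Polynomial.eval_sub, Polynomial.eval_X, sub_sub]
      rw [show (1 : ℂ) + j = j + 1 by ring]
      field_simp
    have hprev := hpy y hy fun i hi => hyj i (by omega)
    rw [hdig, mul_add, ← hqy] at hprev
    rw [Polynomial.eval_add, Nat.cast_succ]
    linear_combination hprev

lemma digammaExpr_eq_digammaCore {n : ℕ} {x : ℝ} (hx : 0 < x)
    (hxj : ∀ i < (n + 1) / 2, x ≠ i + 1) : digammaExpr (n + 1) x = digammaCore n x := by
  -- Since `⌊ℓ/2⌋ ≤ ℓ - 1` for `ℓ ≥ 1`, the binomial has enough factors to absorb every pole.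
  obtain ⟨p, hp, hpy⟩ := exists_choose_mul_digamma_sub n ((n + 1) / 2) (by omega)
  have hev : (fun y : ℝ => Ring.choose ((y : ℂ) - 1) n *
      Complex.digamma ((y : ℂ) - (((n + 1) / 2 : ℕ) : ℂ))) =ᶠ[𝓝 x]
      fun y => chooseMulDigamma n y - p.eval (y : ℂ) := by
    have h2 : ∀ᶠ y in 𝓝 x, ∀ i ∈ Finset.range ((n + 1) / 2), y ≠ (i : ℝ) + 1 := by
      rw [Finset.eventually_all]
      intro i hi
      exact eventually_ne_nhds (hxj i (Finset.mem_range.1 hi))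
    filter_upwards [eventually_gt_nhds hx, h2] with y hy hy2
    exact hpy y hy fun i hi => hy2 i (Finset.mem_range.2 hi)
  have hz : iteratedDeriv n (fun y : ℝ => p.eval (y : ℂ)) x = 0 := by
    exact iteratedDeriv_polynomial_ofReal_eq_zero hp x
  rw [digammaExpr, Nat.add_sub_cancel, hev.iteratedDeriv_eq,
    iteratedDeriv_fun_sub (analyticAt_chooseMulDigamma n hx).contDiffAt
    (analyticAt_polynomial_ofReal p x).contDiffAt, hz, sub_zero, digammaCore]

/-! ### Asymptotics of digamma -/

lemma digamma_ofReal_eq_deriv_log_Gamma {x : ℝ} (hx : 0 < x) :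
    Complex.digamma (x : ℂ) = (deriv (Real.log ∘ Real.Gamma) x : ℝ) := by
  have hr : DifferentiableAt ℝ Real.Gamma x :=
    Real.differentiableAt_Gamma fun m h => Complex.ofReal_ne_neg_natCast hx m (by exact_mod_cast h)
  have h1 := (Complex.differentiableAt_Gamma x
    (Complex.ofReal_ne_neg_natCast hx)).hasDerivAt.comp_ofReal
  have h2 := hr.hasDerivAt.ofReal_comp
  simp only [Complex.Gamma_ofReal] at h1
  rw [Function.comp_def, deriv.log hr (Real.Gamma_pos_of_pos hx).ne', Complex.digamma_def,
    logDeriv_apply, h1.unique h2, Complex.Gamma_ofReal, Complex.ofReal_div]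

/-- By convexity of `log Γ`, its slope `log x` over `[x, x+1]` lies between the derivatives at the
two ends, which differ by `1/x`. -/
lemma deriv_log_Gamma_mem_Icc {x : ℝ} (hx : 0 < x) :
    deriv (Real.log ∘ Real.Gamma) x ∈ Set.Icc (Real.log x - 1 / x) (Real.log x) := by
  have hc := Real.convexOn_log_Gamma
  have hrec (y : ℝ) (hy : 0 < y) : (Real.log ∘ Real.Gamma) (y + 1) =
      (Real.log ∘ Real.Gamma) y + Real.log y := by
    simp only [Function.comp_apply, Real.Gamma_add_one hy.ne',
      Real.log_mul hy.ne' (Real.Gamma_pos_of_pos hy).ne', add_comm]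
  have hder {y : ℝ} (hy : 0 < y) : DifferentiableAt ℝ (Real.log ∘ Real.Gamma) y := by
    refine (Real.differentiableAt_Gamma ?_).log (Real.Gamma_ne_zero ?_) <;>
    exact fun m h => Complex.ofReal_ne_neg_natCast hy m (by exact_mod_cast h)
  have hupper (y : ℝ) (hy : 0 < y) :
      Real.log y ≤ deriv (Real.log ∘ Real.Gamma) (y + 1) := by
    refine (le_of_eq ?_).trans <| hc.slope_le_deriv (Set.mem_Ioi.2 hy)
      (Set.mem_Ioi.2 (by positivity : 0 < y + 1)) (by linarith) (hder (by positivity))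
    rw [slope_def_field, add_sub_cancel_left, div_one, hrec y hy, add_sub_cancel_left]
  have hstep : deriv (Real.log ∘ Real.Gamma) (x + 1) =
      deriv (Real.log ∘ Real.Gamma) x + 1 / x := by
    rw [← deriv_comp_add_const, one_div, ← Real.deriv_log,
      ← deriv_add (hder hx) (Real.differentiableAt_log hx.ne')]
    apply EventuallyEq.deriv_eq
    filter_upwards [eventually_gt_nhds hx] using hrec
  constructor
  · have := hupper x hx
    linarith
  · refine (hc.deriv_le_slope (Set.mem_Ioi.2 hx) (Set.mem_Ioi.2 (by positivity : 0 < x + 1))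
      (by linarith) (hder hx)).trans (le_of_eq ?_)
    rw [slope_def_field, add_sub_cancel_left, div_one, hrec x hx, add_sub_cancel_left]

lemma tendsto_digamma_sub_log :
    Tendsto (fun x : ℝ => Complex.digamma (x : ℂ) - Complex.log (x : ℂ)) atTop (𝓝 0) := by
  refine squeeze_zero_norm' (a := fun x : ℝ => x⁻¹) ?_ tendsto_inv_atTop_zero
  filter_upwards [eventually_gt_atTop 0] with x hx
  have h := deriv_log_Gamma_mem_Icc hx
  rw [digamma_ofReal_eq_deriv_log_Gamma hx, ← Complex.ofReal_log hx.le, ← Complex.ofReal_sub,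
    Complex.norm_real, Real.norm_eq_abs, abs_le, ← one_div]
  have : 0 < 1 / x := by positivity
  constructor <;> linarith [h.1, h.2]

/-! ### Logarithmic and Cauchy potentials of a law with finite first moment -/

/-- `a ↦ 𝔼 [log (a + i s)]` for a measure `μ` on the line. -/
def logPotential (μ : Measure ℝ) (a : ℝ) : ℂ :=
  ∫ s, Complex.log ((a : ℂ) + Complex.I * (s : ℂ)) ∂μ

/-- `a ↦ 𝔼 [1 / (a + i s)]` for a measure `μ` on the line. -/
def cauchyPotential (μ : Measure ℝ) (a : ℝ) : ℂ :=
  ∫ s, ((a : ℂ) + Complex.I * (s : ℂ))⁻¹ ∂μ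

lemma re_ofReal_add_I_mul (a s : ℝ) : ((a : ℂ) + Complex.I * (s : ℂ)).re = a := by simp

lemma im_ofReal_add_I_mul (a s : ℝ) : ((a : ℂ) + Complex.I * (s : ℂ)).im = s := by simp

lemma ofReal_add_I_mul_mem_slitPlane {a s : ℝ} (h : 0 < a ∨ s ≠ 0) :
    (a : ℂ) + Complex.I * (s : ℂ) ∈ Complex.slitPlane := by
  rw [Complex.mem_slitPlane_iff, re_ofReal_add_I_mul, im_ofReal_add_I_mul]
  exact h

lemma norm_inv_ofReal_add_I_mul_le {a : ℝ} (ha : 0 < a) (s : ℝ) :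
    ‖((a : ℂ) + Complex.I * (s : ℂ))⁻¹‖ ≤ a⁻¹ := by
  rw [norm_inv]
  refine inv_anti₀ ha ?_
  have := Complex.abs_re_le_norm ((a : ℂ) + Complex.I * (s : ℂ))
  rwa [re_ofReal_add_I_mul, abs_of_pos ha] at this

/-- Mean value inequality along the vertical line through `a`, where the derivative of `log` has
norm at most `1/a`. -/
lemma norm_log_sub_log_le {a : ℝ} (ha : 0 < a) (s : ℝ) :
    ‖Complex.log ((a : ℂ) + Complex.I * (s : ℂ)) - Complex.log (a : ℂ)‖ ≤ a⁻¹ * |s| := by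
  have h := Convex.norm_image_sub_le_of_norm_hasDerivWithin_le (𝕜 := ℝ) (s := Set.univ)
    (x := 0) (y := s) (C := a⁻¹) (f := fun s : ℝ => Complex.log ((a : ℂ) + Complex.I * (s : ℂ)))
    (f' := fun s : ℝ => Complex.I / ((a : ℂ) + Complex.I * (s : ℂ)))
    (fun s _ => ?_) (fun s _ => ?_) convex_univ trivial trivial
  · simpa using h
  · have h1 : HasDerivAt (fun s : ℝ => (a : ℂ) + Complex.I * (s : ℂ)) (Complex.I * 1) s :=
      (((hasDerivAt_id (s : ℂ)).const_mul Complex.I).const_add (a : ℂ)).comp_ofReal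
    rw [mul_one] at h1
    exact (h1.clog_real (ofReal_add_I_mul_mem_slitPlane (.inl ha))).hasDerivWithinAt
  · rw [div_eq_mul_inv, norm_mul, Complex.norm_I, one_mul]
    exact norm_inv_ofReal_add_I_mul_le ha s

lemma measurable_log_ofReal_add_I_mul (a : ℝ) :
    Measurable fun s : ℝ => Complex.log ((a : ℂ) + Complex.I * (s : ℂ)) :=
  Complex.measurable_log.comp (by fun_prop)

lemma measurable_inv_ofReal_add_I_mul (a : ℝ) :
    Measurable fun s : ℝ => ((a : ℂ) + Complex.I * (s : ℂ))⁻¹ := by fun_prop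

lemma integrable_log_sub_log {μ : Measure ℝ} (hμ : Integrable (fun s : ℝ => s) μ) {a : ℝ}
    (ha : 0 < a) : Integrable (fun s : ℝ =>
      Complex.log ((a : ℂ) + Complex.I * (s : ℂ)) - Complex.log (a : ℂ)) μ :=
  (hμ.abs.const_mul a⁻¹).mono'
    ((measurable_log_ofReal_add_I_mul a).sub_const _).aestronglyMeasurable
    (ae_of_all _ (norm_log_sub_log_le ha))

section Generic

variable {μ : Measure ℝ} [IsProbabilityMeasure μ]

lemma integrable_inv_ofReal_add_I_mul {a : ℝ} (ha : 0 < a) :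
    Integrable (fun s : ℝ => ((a : ℂ) + Complex.I * (s : ℂ))⁻¹) μ :=
  .of_bound (measurable_inv_ofReal_add_I_mul a).aestronglyMeasurable a⁻¹
    (ae_of_all _ (norm_inv_ofReal_add_I_mul_le ha))

lemma integrable_log_of_pos (hμ : Integrable (fun s : ℝ => s) μ) {a : ℝ} (ha : 0 < a) :
    Integrable (fun s : ℝ => Complex.log ((a : ℂ) + Complex.I * (s : ℂ))) μ := by
  refine ((integrable_log_sub_log hμ ha).add (integrable_const (Complex.log (a : ℂ)))).congr
    (ae_of_all _ fun s => ?_)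
  simp

lemma logPotential_sub_log (hμ : Integrable (fun s : ℝ => s) μ) {a : ℝ} (ha : 0 < a) :
    ∫ s : ℝ, (Complex.log ((a : ℂ) + Complex.I * (s : ℂ)) - Complex.log (a : ℂ)) ∂μ =
      logPotential μ a - Complex.log (a : ℂ) := by
  rw [integral_sub (integrable_log_of_pos hμ ha) (integrable_const _)]
  simp [logPotential]

lemma tendsto_logPotential_sub_log (hμ : Integrable (fun s : ℝ => s) μ) :
    Tendsto (fun a : ℝ => logPotential μ a - Complex.log (a : ℂ)) atTop (𝓝 0) := by
  refine squeeze_zero_norm' (a := fun a : ℝ => a⁻¹ * ∫ s, |s| ∂μ) ?_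
    (by simpa using tendsto_inv_atTop_zero.mul_const (∫ s, |s| ∂μ))
  filter_upwards [eventually_gt_atTop 0] with a ha
  rw [← logPotential_sub_log hμ ha, ← integral_const_mul]
  exact norm_integral_le_of_norm_le (hμ.abs.const_mul _) (ae_of_all _ (norm_log_sub_log_le ha))

lemma hasDerivAt_logPotential (hμ : Integrable (fun s : ℝ => s) μ) {a : ℝ} (ha : 0 < a) :
    HasDerivAt (logPotential μ) (cauchyPotential μ a) a := by
  refine (hasDerivAt_integral_of_dominated_loc_of_deriv_le (s := Set.Ioi (a / 2))
    (bound := fun _ => (a / 2)⁻¹)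
    (F' := fun (a : ℝ) (s : ℝ) => ((a : ℂ) + Complex.I * (s : ℂ))⁻¹)
    (Ioi_mem_nhds (by linarith)) (Eventually.of_forall fun b =>
      (measurable_log_ofReal_add_I_mul b).aestronglyMeasurable) (integrable_log_of_pos hμ ha)
    (measurable_inv_ofReal_add_I_mul a).aestronglyMeasurable
    (ae_of_all _ fun s b hb => ?_) (integrable_const _) (ae_of_all _ fun s b hb => ?_)).2
  · have hb' : a / 2 < b := hb
    exact (norm_inv_ofReal_add_I_mul_le (by linarith) s).trans (inv_anti₀ (by linarith) hb'.le)
  · have hb' : a / 2 < b := hb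
    have h1 : HasDerivAt (fun b : ℝ => (b : ℂ) + Complex.I * (s : ℂ)) 1 b :=
      ((hasDerivAt_id (b : ℂ)).add_const _).comp_ofReal
    simpa using h1.clog_real (ofReal_add_I_mul_mem_slitPlane (.inl (by linarith)))

lemma tendsto_mul_cauchyPotential (hμ : Integrable (fun s : ℝ => s) μ) :
    Tendsto (fun a : ℝ => (a : ℂ) * cauchyPotential μ a) atTop (𝓝 1) := by
  rw [← tendsto_sub_nhds_zero_iff]
  refine squeeze_zero_norm' (a := fun a : ℝ => a⁻¹ * ∫ s, |s| ∂μ) ?_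
    (by simpa using tendsto_inv_atTop_zero.mul_const (∫ s, |s| ∂μ))
  filter_upwards [eventually_gt_atTop 0] with a ha
  have h1 : (a : ℂ) * cauchyPotential μ a - 1 =
      ∫ s : ℝ, ((a : ℂ) * ((a : ℂ) + Complex.I * (s : ℂ))⁻¹ - 1) ∂μ := by
    rw [integral_sub ((integrable_inv_ofReal_add_I_mul ha).const_mul _) (integrable_const _),
      integral_const_mul]
    simp [cauchyPotential]
  rw [h1, ← integral_const_mul]
  refine norm_integral_le_of_norm_le (hμ.abs.const_mul _) (ae_of_all _ fun s => ?_)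
  have hne := Complex.slitPlane_ne_zero (ofReal_add_I_mul_mem_slitPlane (s := s) (.inl ha))
  have : (a : ℂ) * ((a : ℂ) + Complex.I * (s : ℂ))⁻¹ - 1 =
      -(Complex.I * s) * ((a : ℂ) + Complex.I * (s : ℂ))⁻¹ := by
    field_simp
    ring
  rw [this, norm_mul, norm_neg, norm_mul, Complex.norm_I, one_mul, Complex.norm_real,
    Real.norm_eq_abs, mul_comm]
  gcongr
  exact norm_inv_ofReal_add_I_mul_le ha s

lemma tendsto_cauchyPotential (hμ : Integrable (fun s : ℝ => s) μ) :
    Tendsto (cauchyPotential μ) atTop (𝓝 0) := by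
  have h := (Complex.continuous_ofReal.tendsto 0).comp tendsto_inv_atTop_zero |>.mul
    (tendsto_mul_cauchyPotential hμ)
  simp only [Complex.ofReal_zero, zero_mul] at h
  refine h.congr' ?_
  filter_upwards [eventually_gt_atTop 0] with a ha
  have : (a : ℂ) ≠ 0 := by exact_mod_cast ha.ne'
  simp only [Function.comp_apply, Complex.ofReal_inv]
  field_simp

/-- Write `1/(a + is)` as the integral of `exp (-(a + is) t)` over `t > 0` and apply Fubini. -/
lemma cauchyPotential_eq_laplace {a : ℝ} (ha : 0 < a) :
    cauchyPotential μ a = ∫ t in Set.Ioi (0 : ℝ), (Real.exp (-a * t) : ℂ) * charFun μ (-t) := by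
  have hint : Integrable (Function.uncurry fun (s t : ℝ) =>
      (Real.exp (-a * t) : ℂ) * Complex.exp (↑(-t * s) * Complex.I))
      (μ.prod (volume.restrict (Set.Ioi (0 : ℝ)))) := by
    have h0 : Integrable (fun t : ℝ => Real.exp (-a * t)) (volume.restrict (Set.Ioi (0 : ℝ))) :=
      exp_neg_integrableOn_Ioi 0 ha
    refine (h0.comp_snd μ).mono' (by
      refine Measurable.aestronglyMeasurable ?_
      unfold Function.uncurry
      fun_prop) (ae_of_all _ fun p => ?_)
    simp only [Function.uncurry, norm_mul, Complex.norm_exp_ofReal_mul_I, mul_one,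
      Complex.norm_real, Real.norm_eq_abs, abs_of_pos (Real.exp_pos _), le_refl]
  have hleft : ∀ s : ℝ, ((a : ℂ) + Complex.I * (s : ℂ))⁻¹ = ∫ t in Set.Ioi (0 : ℝ),
      (Real.exp (-a * t) : ℂ) * Complex.exp (↑(-t * s) * Complex.I) := by
    intro s
    have hre : (-((a : ℂ) + Complex.I * (s : ℂ))).re < 0 := by
      rw [Complex.neg_re, re_ofReal_add_I_mul]
      linarith
    have h := integral_exp_mul_complex_Ioi hre 0
    rw [Complex.ofReal_zero, mul_zero, Complex.exp_zero, neg_div_neg_eq, one_div] at h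
    rw [← h]
    congr 1 with t
    rw [Complex.ofReal_exp, ← Complex.exp_add]
    congr 1
    push_cast
    ring
  simp only [cauchyPotential, hleft]
  rw [integral_integral_swap hint]
  congr 1 with t
  rw [integral_const_mul, charFun_apply_real]
  congr 2 with s
  push_cast
  rfl

lemma integral_Ioc_exp_neg_mul (a : ℝ) {t : ℝ} (ht : t ≠ 0) :
    ∫ b in Set.Ioc (a - 1 / 2) (a + 1 / 2), Real.exp (-b * t) =
      Real.exp (-a * t) * (2 * Real.sinh (t / 2) / t) := by
  have hd : ∀ b ∈ Set.uIcc (a - 1 / 2) (a + 1 / 2),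
      HasDerivAt (fun b => -Real.exp (-b * t) / t) (Real.exp (-b * t)) b := by
    intro b _
    have h1 : HasDerivAt (fun b => -b * t) (-t) b := by
      simpa using (hasDerivAt_id b).fun_neg.mul_const t
    refine (h1.exp.fun_neg.div_const t).congr_deriv ?_
    field_simp
  rw [← intervalIntegral.integral_of_le (by linarith),
    intervalIntegral.integral_eq_sub_of_hasDerivAt hd
      (Continuous.intervalIntegrable (by fun_prop) _ _), Real.sinh_eq,
    show -(a + 1 / 2) * t = -a * t + -(t / 2) by ring,
    show -(a - 1 / 2) * t = -a * t + t / 2 by ring, Real.exp_add, Real.exp_add]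
  ring

/-- The derivative of the logarithmic potential is the Cauchy potential; its Laplace formula is
integrated over a unit window, which `1/2 < a` keeps inside the positive half-line. -/
lemma logPotential_sub_eq_laplace (hμ : Integrable (fun s : ℝ => s) μ) {a : ℝ} (ha : 1 / 2 < a) :
    logPotential μ (a + 1 / 2) - logPotential μ (a - 1 / 2) =
      ∫ t in Set.Ioi (0 : ℝ), (Real.exp (-a * t) : ℂ) * (2 * Real.sinh (t / 2) / t : ℝ) *
        charFun μ (-t) := by
  have hint : Integrable (Function.uncurry fun (b t : ℝ) =>
      (Real.exp (-b * t) : ℂ) * charFun μ (-t))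
      ((volume.restrict (Set.Ioc (a - 1 / 2) (a + 1 / 2))).prod
        (volume.restrict (Set.Ioi (0 : ℝ)))) := by
    have h0 : Integrable (fun t : ℝ => Real.exp (-(a - 1 / 2) * t))
        (volume.restrict (Set.Ioi (0 : ℝ))) := exp_neg_integrableOn_Ioi 0 (by linarith)
    refine (h0.comp_snd _).mono' (by
      refine Measurable.aestronglyMeasurable ?_
      unfold Function.uncurry
      fun_prop) ?_
    rw [Measure.prod_restrict]
    refine (ae_restrict_iff' (measurableSet_Ioc.prod measurableSet_Ioi)).2 (ae_of_all _ ?_)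
    rintro ⟨b, t⟩ ⟨hb, ht⟩
    have ht' : 0 < t := ht
    have hb' : a - 1 / 2 < b := hb.1
    simp only [Function.uncurry, norm_mul, Complex.norm_real, Real.norm_eq_abs,
      abs_of_pos (Real.exp_pos _)]
    refine (mul_le_of_le_one_right (Real.exp_pos _).le (norm_charFun_le_one _)).trans ?_
    gcongr
  have hpos : ∀ b ∈ Set.Ioc (a - 1 / 2) (a + 1 / 2), 0 < b := fun b hb => by linarith [hb.1]
  have hcp : ∀ b ∈ Set.Ioc (a - 1 / 2) (a + 1 / 2), cauchyPotential μ b =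
      ∫ t in Set.Ioi (0 : ℝ), (Real.exp (-b * t) : ℂ) * charFun μ (-t) :=
    fun b hb => cauchyPotential_eq_laplace (hpos b hb)
  have hle : a - 1 / 2 ≤ a + 1 / 2 := by linarith
  have hftc : logPotential μ (a + 1 / 2) - logPotential μ (a - 1 / 2) =
      ∫ b in (a - 1 / 2)..(a + 1 / 2), cauchyPotential μ b := by
    refine (intervalIntegral.integral_eq_sub_of_hasDerivAt (fun b hb => ?_) ?_).symm
    · rw [Set.uIcc_of_le hle] at hb
      exact hasDerivAt_logPotential hμ (by linarith [hb.1])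
    · rw [intervalIntegrable_iff_integrableOn_Ioc_of_le hle]
      exact IntegrableOn.congr_fun hint.integral_prod_left (fun b hb => (hcp b hb).symm)
        measurableSet_Ioc
  rw [hftc, intervalIntegral.integral_of_le hle, setIntegral_congr_fun measurableSet_Ioc hcp,
    integral_integral_swap hint]
  refine setIntegral_congr_fun measurableSet_Ioi fun t ht => ?_
  rw [integral_mul_const, integral_complex_ofReal, integral_Ioc_exp_neg_mul a (ne_of_gt ht),
    Complex.ofReal_mul]

/-- The hypothesis says that the multiplier `2 sinh (t/2) / t` of the unit window turns the
transform of `ν` into that of `μ`. It is applied to consecutive convolution powers. -/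
lemma logPotential_sub_eq_cauchyPotential {ν : Measure ℝ} [IsProbabilityMeasure ν]
    (hν : Integrable (fun s : ℝ => s) ν)
    (h : ∀ t : ℝ, 0 < t → charFun ν (-t) * (2 * Real.sinh (t / 2) : ℝ) = t * charFun μ (-t))
    {a : ℝ} (ha : 1 / 2 < a) :
    logPotential ν (a + 1 / 2) - logPotential ν (a - 1 / 2) = cauchyPotential μ a := by
  rw [logPotential_sub_eq_laplace hν ha, cauchyPotential_eq_laplace (by linarith)]
  refine setIntegral_congr_fun measurableSet_Ioi fun t ht => ?_
  have ht0 : (t : ℂ) ≠ 0 := by exact_mod_cast (ne_of_gt ht)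
  have := h t ht
  push_cast at this ⊢
  field_simp
  linear_combination this

end Generic

/-! ### Laws of bounded density: integrability at the singularity, and reflection -/

section Density

variable {μ : Measure ℝ} [IsProbabilityMeasure μ] {C : NNReal}

omit [IsProbabilityMeasure μ] in
lemma ae_ne_zero_of_le_smul_volume (hC : μ ≤ C • volume) : ∀ᵐ s : ℝ ∂μ, s ≠ 0 := by
  have h0 : (C • volume : Measure ℝ) {0} = 0 := by simp
  rw [ae_iff]
  simpa using le_antisymm ((hC {0}).trans h0.le) zero_le

omit [IsProbabilityMeasure μ] in
-- Near `0` the bounded density reduces to Lebesgue integrability of `log`; away from it `|log s| ≤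
-- |s|`.
lemma integrable_log_of_le_smul_volume (hC : μ ≤ C • volume)
    (hμ : Integrable (fun s : ℝ => s) μ) : Integrable Real.log μ := by
  have h1 : Integrable ((Set.Icc (-1 : ℝ) 1).indicator Real.log) μ := by
    have h : IntegrableOn Real.log (Set.Icc (-1 : ℝ) 1) volume := by
      rw [integrableOn_Icc_iff_integrableOn_Ioc]
      exact (intervalIntegrable_iff_integrableOn_Ioc_of_le (by norm_num)).1
        intervalIntegral.intervalIntegrable_log'
    exact ((h.integrable_indicator measurableSet_Icc).smul_measure_nnreal (c := C)).mono_measure hC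
  refine (h1.abs.add hμ.abs).mono' Real.measurable_log.aestronglyMeasurable (ae_of_all _ fun s => ?_)
  simp only [Pi.add_apply, Real.norm_eq_abs]
  by_cases hs : s ∈ Set.Icc (-1 : ℝ) 1
  · rw [Set.indicator_of_mem hs]
    linarith [abs_nonneg s]
  · rw [Set.indicator_of_notMem hs, abs_zero, zero_add, ← Real.log_abs]
    have h1 : 1 ≤ |s| := by
      by_contra h
      exact hs (abs_le.1 (not_le.1 h).le)
    rw [abs_of_nonneg (Real.log_nonneg h1)]
    exact Real.log_le_self (abs_nonneg s)

lemma norm_log_ofReal_add_I_mul_le (a : ℝ) {s : ℝ} (hs : s ≠ 0) :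
    ‖Complex.log ((a : ℂ) + Complex.I * (s : ℂ))‖ ≤ |Real.log s| + |a| + |s| + Real.pi := by
  set z : ℂ := (a : ℂ) + Complex.I * (s : ℂ) with hz
  have h1 : |s| ≤ ‖z‖ := by
    have := Complex.abs_im_le_norm z
    rwa [hz, im_ofReal_add_I_mul, ← hz] at this
  have h2 : ‖z‖ ≤ |a| + |s| := by
    refine (Complex.norm_le_abs_re_add_abs_im z).trans_eq ?_
    rw [hz, im_ofReal_add_I_mul, re_ofReal_add_I_mul]
  have hs0 : 0 < |s| := abs_pos.2 hs
  have h3 : |Real.log ‖z‖| ≤ |Real.log s| + |a| + |s| := by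
    have h4 := Real.log_le_log hs0 h1
    rw [Real.log_abs] at h4
    have h5 := Real.log_le_self (norm_nonneg z)
    rw [abs_le]
    constructor <;> linarith [abs_nonneg a, neg_abs_le (Real.log s), abs_nonneg (Real.log s)]
  refine (Complex.norm_le_abs_re_add_abs_im _).trans ?_
  rw [Complex.log_re, Complex.log_im]
  exact add_le_add h3 (Complex.abs_arg_le_pi z)

lemma integrable_log_ofReal_add_I_mul (hC : μ ≤ C • volume)
    (hμ : Integrable (fun s : ℝ => s) μ) (a : ℝ) :
    Integrable (fun s : ℝ => Complex.log ((a : ℂ) + Complex.I * (s : ℂ))) μ := by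
  refine Integrable.mono' (((integrable_log_of_le_smul_volume hC hμ).abs.add
    (integrable_const |a|)).add hμ.abs |>.add (integrable_const Real.pi))
    (measurable_log_ofReal_add_I_mul a).aestronglyMeasurable ?_
  filter_upwards [ae_ne_zero_of_le_smul_volume hC] with s hs
  exact norm_log_ofReal_add_I_mul_le a hs

lemma continuousAt_logPotential_zero (hC : μ ≤ C • volume)
    (hμ : Integrable (fun s : ℝ => s) μ) : ContinuousAt (logPotential μ) 0 := by
  refine continuousAt_of_dominated (bound := fun s => |Real.log s| + 1 + |s| + Real.pi)
    (Eventually.of_forall fun a => (measurable_log_ofReal_add_I_mul a).aestronglyMeasurable) ?_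
    (((integrable_log_of_le_smul_volume hC hμ).abs.add
      (integrable_const 1)).add hμ.abs |>.add (integrable_const Real.pi)) ?_
  · filter_upwards [Metric.ball_mem_nhds (0 : ℝ) one_pos] with a ha
    filter_upwards [ae_ne_zero_of_le_smul_volume hC] with s hs
    have ha' : |a| < 1 := by simpa using ha
    exact (norm_log_ofReal_add_I_mul_le a hs).trans (by linarith)
  · filter_upwards [ae_ne_zero_of_le_smul_volume hC] with s hs
    refine ContinuousAt.clog (by fun_prop) (ofReal_add_I_mul_mem_slitPlane (.inr hs))

lemma log_neg_sub_log_of_pos (a : ℝ) {s : ℝ} (hs : 0 < s) :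
    Complex.log (((-a : ℝ) : ℂ) + Complex.I * (s : ℂ)) -
      Complex.log ((a : ℂ) + Complex.I * ((-s : ℝ) : ℂ)) = Real.pi * Complex.I := by
  have h : (a : ℂ) + Complex.I * ((-s : ℝ) : ℂ) = -(((-a : ℝ) : ℂ) + Complex.I * (s : ℂ)) := by
    push_cast
    ring
  have harg := Complex.arg_neg_eq_arg_sub_pi_of_im_pos
    (x := ((-a : ℝ) : ℂ) + Complex.I * (s : ℂ)) (by rwa [im_ofReal_add_I_mul])
  rw [h, Complex.log, Complex.log, norm_neg, harg]
  push_cast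
  ring

/-- The numbers `-a + is` and `a - is` are opposite, so their principal logarithms differ by `πi`
times the sign of `s`, an odd function that integrates to `0` against a symmetric law. -/
lemma logPotential_neg (hC : μ ≤ C • volume) (hμ : Integrable (fun s : ℝ => s) μ)
    (hsymm : μ.map (fun s => -s) = μ) (a : ℝ) : logPotential μ (-a) = logPotential μ a := by
  have hneg : ∀ f : ℝ → ℂ, Measurable f → ∫ s, f (-s) ∂μ = ∫ s, f s ∂μ := by
    intro f hf
    conv_rhs => rw [← hsymm]
    rw [integral_map measurable_neg.aemeasurable hf.aestronglyMeasurable]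
  have hi := integrable_log_ofReal_add_I_mul hC hμ
  have hi' : Integrable (fun s : ℝ => Complex.log ((a : ℂ) + Complex.I * ((-s : ℝ) : ℂ))) μ := by
    have h := hi a
    rw [← hsymm] at h
    exact h.comp_measurable measurable_neg
  set f : ℝ → ℂ := fun s => Complex.log (((-a : ℝ) : ℂ) + Complex.I * (s : ℂ)) -
      Complex.log ((a : ℂ) + Complex.I * ((-s : ℝ) : ℂ)) with hf
  have hfm : Measurable f := (measurable_log_ofReal_add_I_mul (-a)).sub
    ((measurable_log_ofReal_add_I_mul a).comp measurable_neg)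
  have hodd : ∀ᵐ s ∂μ, f (-s) = -f s := by
    filter_upwards [ae_ne_zero_of_le_smul_volume hC] with s hs
    have hflip : ∀ b t : ℝ, -(Complex.log (((-b : ℝ) : ℂ) + Complex.I * ((t : ℝ) : ℂ)) -
        Complex.log ((b : ℂ) + Complex.I * ((-t : ℝ) : ℂ))) =
        Complex.log (((-(-b) : ℝ) : ℂ) + Complex.I * ((-t : ℝ) : ℂ)) -
        Complex.log (((-b : ℝ) : ℂ) + Complex.I * ((-(-t) : ℝ) : ℂ)) := by
      intro b t
      simp
    rcases hs.lt_or_gt with h | h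
    · have h1 := log_neg_sub_log_of_pos a (s := -s) (by linarith)
      have h2 := log_neg_sub_log_of_pos (-a) (s := -s) (by linarith)
      rw [← hflip, neg_eq_iff_eq_neg] at h2
      simp only [hf]
      rw [h1, h2, neg_neg]
    · have h1 := log_neg_sub_log_of_pos a h
      have h2 := log_neg_sub_log_of_pos (-a) h
      have h3 := hflip a (-s)
      simp only [neg_neg] at h2 h3
      simp only [hf, neg_neg]
      rw [h1, ← h2]
      linear_combination -h3
  have hzero : ∫ s, f s ∂μ = 0 := by
    have h := hneg f hfm
    rw [integral_congr_ae hodd, integral_neg] at h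
    exact self_eq_neg.1 h.symm
  rw [hf, integral_sub (hi (-a)) hi', hneg _ (measurable_log_ofReal_add_I_mul a)] at hzero
  exact sub_eq_zero.1 hzero

end Density

/-! ### The squared hyperbolic secant law and its characteristic function -/

/-- The density `v ↦ (π / 2) * sech (π v) ^ 2`. -/
def sechSqDensity (v : ℝ) : ℝ := Real.pi / 2 * (1 / Real.cosh (Real.pi * v)) ^ 2

lemma continuous_sechSqDensity : Continuous sechSqDensity := by
  unfold sechSqDensity
  have : ∀ v : ℝ, Real.cosh (Real.pi * v) ≠ 0 := fun v => (Real.cosh_pos _).ne'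
  fun_prop (disch := simpa)

lemma sechSqDensity_pos (v : ℝ) : 0 < sechSqDensity v := by
  have := Real.cosh_pos (Real.pi * v)
  unfold sechSqDensity
  positivity

/-- From `cosh (πv) = 1 + 2 sinh² (πv/2)` and `|sinh u| ≥ |u|`. This one bound yields integrability,
the finite first moment and the density bound `2`. -/
lemma sechSqDensity_le (v : ℝ) : sechSqDensity v ≤ 2 * (1 / (1 + v ^ 2)) ^ 2 := by
  have hc : 1 + v ^ 2 ≤ Real.cosh (Real.pi * v) := by
    have h1 : Real.cosh (Real.pi * v) = 1 + 2 * Real.sinh (Real.pi * v / 2) ^ 2 := by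
      have := Real.cosh_two_mul (Real.pi * v / 2)
      rw [show 2 * (Real.pi * v / 2) = Real.pi * v by ring] at this
      rw [this, Real.cosh_sq]
      ring
    have h2 : (Real.pi * v / 2) ^ 2 ≤ Real.sinh (Real.pi * v / 2) ^ 2 := by
      rw [sq_le_sq, Real.abs_sinh]
      exact Real.self_le_sinh_iff.2 (abs_nonneg _)
    nlinarith [Real.pi_gt_three, sq_nonneg v, mul_nonneg (sub_nonneg.2 Real.pi_gt_three.le)
      (sq_nonneg v), mul_nonneg (mul_self_nonneg (Real.pi - 3)) (sq_nonneg v)]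
  unfold sechSqDensity
  have hpi : Real.pi / 2 ≤ 2 := by linarith [Real.pi_lt_four]
  gcongr

/-- The logistic substitution maps the density to the uniform density on `(0, 1)`. -/
lemma hasDerivAt_sigmoid_two_pi_mul (v : ℝ) :
    HasDerivAt (fun v : ℝ => Real.sigmoid (2 * Real.pi * v)) (sechSqDensity v) v := by
  have h1 : HasDerivAt (fun v : ℝ => 2 * Real.pi * v) (2 * Real.pi) v := by
    simpa using (hasDerivAt_id v).const_mul (2 * Real.pi)
  refine ((Real.hasDerivAt_sigmoid (2 * Real.pi * v)).comp v h1).congr_deriv ?_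
  have hE := Real.exp_pos (Real.pi * v)
  rw [Real.sigmoid_def, sechSqDensity, Real.cosh_eq,
    show -(2 * Real.pi * v) = -(Real.pi * v) + -(Real.pi * v) by ring, Real.exp_add, Real.exp_neg]
  field_simp
  ring

lemma range_sigmoid_two_pi_mul :
    (fun v : ℝ => Real.sigmoid (2 * Real.pi * v)) '' Set.univ = Set.Ioo 0 1 := by
  rw [← Real.range_sigmoid, Set.image_univ]
  have : Function.Surjective fun v : ℝ => 2 * Real.pi * v := fun w =>
    ⟨w / (2 * Real.pi), by field_simp⟩
  exact this.range_comp Real.sigmoid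

lemma integral_sechSqDensity_smul {g : ℝ → ℂ} :
    ∫ v, sechSqDensity v • g (Real.sigmoid (2 * Real.pi * v)) = ∫ p in Set.Ioo (0 : ℝ) 1, g p := by
  have h := integral_image_eq_integral_abs_deriv_smul (F := ℂ) MeasurableSet.univ
    (fun v _ => (hasDerivAt_sigmoid_two_pi_mul v).hasDerivWithinAt)
    (fun v _ w _ hvw => by
      have := Real.sigmoid_injective hvw
      exact mul_left_cancel₀ Real.two_pi_pos.ne' this) g
  rw [range_sigmoid_two_pi_mul, Measure.restrict_univ] at h
  rw [h]
  simp only [abs_of_pos (sechSqDensity_pos _)]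

lemma integrable_sechSqDensity : Integrable sechSqDensity := by
  refine (integrable_inv_one_add_sq.const_mul 2).mono'
    continuous_sechSqDensity.aestronglyMeasurable (ae_of_all _ fun v => ?_)
  rw [Real.norm_eq_abs, abs_of_pos (sechSqDensity_pos v)]
  refine (sechSqDensity_le v).trans ?_
  have h1 : (1 + v ^ 2)⁻¹ ≤ 1 := inv_le_one_of_one_le₀ (by nlinarith [sq_nonneg v])
  have h0 : 0 ≤ (1 + v ^ 2)⁻¹ := by positivity
  rw [one_div]
  nlinarith

lemma integral_sechSqDensity : ∫ v, sechSqDensity v = 1 := by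
  have h := integral_sechSqDensity_smul (g := fun _ => 1)
  simp only [Complex.real_smul, mul_one, integral_complex_ofReal] at h
  have h2 : ∫ _ in Set.Ioo (0 : ℝ) 1, (1 : ℂ) = 1 := by simp
  rw [h2] at h
  exact_mod_cast h

lemma sechSqLaw_eq : sechSqLaw = volume.withDensity fun v => ENNReal.ofReal (sechSqDensity v) := rfl

instance isProbabilityMeasure_sechSqLaw : IsProbabilityMeasure sechSqLaw := by
  constructor
  rw [sechSqLaw_eq, withDensity_apply _ MeasurableSet.univ, Measure.restrict_univ,
    ← ofReal_integral_eq_lintegral_ofReal integrable_sechSqDensity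
    (ae_of_all _ fun v => (sechSqDensity_pos v).le), integral_sechSqDensity, ENNReal.ofReal_one]

lemma integral_sechSqLaw (f : ℝ → ℂ) :
    ∫ v, f v ∂sechSqLaw = ∫ v, sechSqDensity v • f v := by
  rw [sechSqLaw_eq, integral_withDensity_eq_integral_toReal_smul
    (by have := continuous_sechSqDensity; fun_prop) (ae_of_all _ fun v => ENNReal.ofReal_lt_top)]
  simp only [ENNReal.toReal_ofReal (sechSqDensity_pos _).le]

lemma sechSqLaw_le : sechSqLaw ≤ (2 : NNReal) • volume := by
  have h : (2 : NNReal) • (volume : Measure ℝ) = volume.withDensity fun _ => (2 : NNReal) := by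
    rw [withDensity_const]
    rfl
  rw [sechSqLaw_eq, h]
  refine withDensity_mono (ae_of_all _ fun v => ?_)
  rw [← ENNReal.ofReal_coe_nnreal]
  refine ENNReal.ofReal_le_ofReal ((sechSqDensity_le v).trans ?_)
  have h1 : (1 + v ^ 2)⁻¹ ≤ 1 := inv_le_one_of_one_le₀ (by nlinarith [sq_nonneg v])
  have h0 : 0 ≤ (1 + v ^ 2)⁻¹ := by positivity
  rw [one_div]
  push_cast
  nlinarith

lemma integrable_id_sechSqLaw : Integrable (fun s : ℝ => s) sechSqLaw := by
  rw [sechSqLaw_eq, integrable_withDensity_iff (by have := continuous_sechSqDensity; fun_prop)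
    (ae_of_all _ fun v => ENNReal.ofReal_lt_top)]
  simp only [ENNReal.toReal_ofReal (sechSqDensity_pos _).le]
  refine (integrable_inv_one_add_sq.const_mul 2).mono'
    (continuous_id.mul continuous_sechSqDensity).aestronglyMeasurable (ae_of_all _ fun v => ?_)
  rw [norm_mul, Real.norm_eq_abs, Real.norm_eq_abs, abs_of_pos (sechSqDensity_pos v)]
  have hv : |v| ≤ 1 + v ^ 2 := by nlinarith [sq_abs v, sq_nonneg (|v| - 1), abs_nonneg v]
  calc |v| * sechSqDensity v ≤ (1 + v ^ 2) * (2 * (1 / (1 + v ^ 2)) ^ 2) :=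
        mul_le_mul hv (sechSqDensity_le v) (sechSqDensity_pos v).le (by positivity)
    _ = 2 * (1 + v ^ 2)⁻¹ := by
        have : 1 + v ^ 2 ≠ 0 := by positivity
        field_simp

/-- With `p = sigmoid (2πv)` one has `v = log (p/(1-p)) / (2π)`, so `exp (itv)` becomes a product of
imaginary powers of `p` and `1 - p`, integrated against the uniform law. -/
lemma charFun_sechSqLaw_eq_betaIntegral (t : ℝ) :
    charFun sechSqLaw t = Complex.betaIntegral (1 + (t / (2 * Real.pi) : ℝ) * Complex.I)
      (1 - (t / (2 * Real.pi) : ℝ) * Complex.I) := by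
  rw [charFun_apply_real, integral_sechSqLaw, Complex.betaIntegral,
    intervalIntegral.integral_of_le zero_le_one, integral_Ioc_eq_integral_Ioo,
    ← integral_sechSqDensity_smul]
  congr 1 with v
  congr 1
  set p := Real.sigmoid (2 * Real.pi * v) with hp
  have hp0 : 0 < p := Real.sigmoid_pos _
  have hp1 : 0 < 1 - p := sub_pos.2 (Real.sigmoid_lt_one _)
  have hlog : Real.log p - Real.log (1 - p) = 2 * Real.pi * v := by
    have h := Real.sigmoid_mul_rexp_neg (2 * Real.pi * v)
    rw [Real.sigmoid_neg, ← hp] at h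
    rw [← h, Real.log_mul hp0.ne' (Real.exp_pos _).ne', Real.log_exp]
    ring
  have h1 : (1 : ℂ) - (p : ℂ) = ((1 - p : ℝ) : ℂ) := by push_cast; rfl
  rw [h1, Complex.cpow_def_of_ne_zero (by exact_mod_cast hp0.ne'),
    Complex.cpow_def_of_ne_zero (by exact_mod_cast hp1.ne'), ← Complex.ofReal_log hp0.le,
    ← Complex.ofReal_log hp1.le, ← Complex.exp_add]
  congr 1
  have hv : (v : ℂ) = (Real.log p - Real.log (1 - p)) / (2 * Real.pi) := by
    have hpi : (Real.pi : ℂ) ≠ 0 := by exact_mod_cast Real.pi_ne_zero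
    rw [← Complex.ofReal_sub, hlog]
    push_cast
    field_simp
  rw [hv]
  push_cast
  ring

/-- Euler's reflection formula: `B(1+w, 1-w) = w Γ(w) Γ(1-w) = πw / sin (πw)` at `w = it/(2π)`. The
product form also covers `t = 0`. -/
lemma charFun_sechSqLaw_mul_sinh (t : ℝ) :
    charFun sechSqLaw t * (2 * Real.sinh (t / 2) : ℝ) = t := by
  rcases eq_or_ne t 0 with rfl | ht
  · simp
  set w : ℂ := (t / (2 * Real.pi) : ℝ) * Complex.I with hw
  have hw0 : w ≠ 0 := mul_ne_zero (by exact_mod_cast div_ne_zero ht Real.two_pi_pos.ne')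
    Complex.I_ne_zero
  have hpi : (Real.pi : ℂ) ≠ 0 := by exact_mod_cast Real.pi_ne_zero
  have hre : w.re = 0 := by rw [hw, Complex.re_ofReal_mul, Complex.I_re, mul_zero]
  have hsin : Complex.sin (Real.pi * w) = (Real.sinh (t / 2) : ℝ) * Complex.I := by
    have : (Real.pi : ℂ) * w = ((t / 2 : ℝ) : ℂ) * Complex.I := by
      rw [hw]
      push_cast
      field_simp
    rw [this, Complex.sin_mul_I, Complex.ofReal_sinh]
  have hsinh : (Real.sinh (t / 2) : ℂ) ≠ 0 := by
    exact_mod_cast fun h => ht (by linarith [Real.sinh_eq_zero.1 h])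
  have hB := Complex.Gamma_mul_Gamma_eq_betaIntegral (s := 1 + w) (t := 1 - w)
    (by simp [hre]) (by simp [hre])
  have hG2 : Complex.Gamma (1 + w + (1 - w)) = 1 := by
    rw [show 1 + w + (1 - w) = 1 + 1 by ring, Complex.Gamma_add_one 1 one_ne_zero,
      Complex.Gamma_one, mul_one]
  rw [hG2, one_mul, add_comm 1 w, Complex.Gamma_add_one w hw0, mul_assoc,
    Complex.Gamma_mul_Gamma_one_sub, hsin] at hB
  rw [charFun_sechSqLaw_eq_betaIntegral, ← hw, add_comm 1 w, ← hB, hw]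
  push_cast at hsinh ⊢
  field_simp

/-! ### Convolution powers -/

/-- The `n`-fold convolution power of the squared hyperbolic secant law. -/
def sechSqConvPow : ℕ → Measure ℝ
  | 0 => Measure.dirac 0
  | n + 1 => Measure.conv (sechSqConvPow n) sechSqLaw

instance isProbabilityMeasure_sechSqConvPow (n : ℕ) : IsProbabilityMeasure (sechSqConvPow n) := by
  induction n with
  | zero => exact Measure.dirac.isProbabilityMeasure
  | succ n ih =>
    rw [sechSqConvPow]
    infer_instance

lemma charFun_sechSqConvPow (n : ℕ) (t : ℝ) :
    charFun (sechSqConvPow n) t = charFun sechSqLaw t ^ n := by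
  induction n with
  | zero => simp [sechSqConvPow]
  | succ n ih => rw [sechSqConvPow, charFun_conv, ih, pow_succ]

lemma integrable_id_sechSqConvPow (n : ℕ) : Integrable (fun s : ℝ => s) (sechSqConvPow n) := by
  induction n with
  | zero =>
    rw [sechSqConvPow]
    exact integrable_dirac (by simp)
  | succ n ih =>
    rw [sechSqConvPow, Measure.conv, integrable_map_measure (by fun_prop) (by fun_prop)]
    exact (ih.comp_fst sechSqLaw).add (integrable_id_sechSqLaw.comp_snd _)

/-- Every translate of `ν` obeys the same bound by translation invariance, and averaging over the
probability measure `μ` preserves it. -/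
lemma conv_le_smul_volume {μ ν : Measure ℝ} [IsProbabilityMeasure μ] [SFinite ν] {C : NNReal}
    (hν : ν ≤ C • volume) : Measure.conv μ ν ≤ C • volume := by
  refine Measure.le_intro fun s hs _ => ?_
  have hm : Measurable (s.indicator (1 : ℝ → ENNReal)) := measurable_one.indicator hs
  rw [← lintegral_indicator_one hs, Measure.lintegral_conv hm, ← lintegral_indicator_one hs]
  calc ∫⁻ x, ∫⁻ y, s.indicator (1 : ℝ → ENNReal) (x + y) ∂ν ∂μ
      ≤ ∫⁻ _, ∫⁻ y, s.indicator (1 : ℝ → ENNReal) y ∂(C • volume) ∂μ := by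
        refine lintegral_mono fun x => ?_
        refine (lintegral_mono' hν le_rfl).trans ?_
        rw [lintegral_smul_measure, lintegral_smul_measure,
          lintegral_add_left_eq_self (s.indicator (1 : ℝ → ENNReal)) x]
    _ = ∫⁻ y, s.indicator (1 : ℝ → ENNReal) y ∂(C • volume) := by simp

lemma sechSqConvPow_succ_le (n : ℕ) : sechSqConvPow (n + 1) ≤ (2 : NNReal) • volume :=
  conv_le_smul_volume sechSqLaw_le

lemma charFun_sechSqLaw_neg (t : ℝ) : charFun sechSqLaw (-t) = charFun sechSqLaw t := by
  rcases eq_or_ne t 0 with rfl | ht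
  · simp
  have h1 := charFun_sechSqLaw_mul_sinh t
  have h2 := charFun_sechSqLaw_mul_sinh (-t)
  have hsinh : (Real.sinh (t / 2) : ℂ) ≠ 0 := by
    exact_mod_cast fun h => ht (by linarith [Real.sinh_eq_zero.1 h])
  rw [neg_div, Real.sinh_neg] at h2
  have : (2 * (Real.sinh (t / 2) : ℂ)) ≠ 0 := mul_ne_zero two_ne_zero hsinh
  refine mul_right_cancel₀ this ?_
  push_cast at h1 h2 ⊢
  linear_combination -h2 - h1

lemma map_neg_sechSqConvPow (n : ℕ) : (sechSqConvPow n).map (fun s => -s) = sechSqConvPow n := by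
  have : IsProbabilityMeasure ((sechSqConvPow n).map (fun s => -s)) :=
    Measure.isProbabilityMeasure_map measurable_neg.aemeasurable
  refine Measure.ext_of_charFun ?_
  ext t
  have h := charFun_map_mul (μ := sechSqConvPow n) (-1) t
  simp only [neg_one_mul] at h
  rw [h, charFun_sechSqConvPow, charFun_sechSqConvPow, charFun_sechSqLaw_neg]

lemma logPotential_sechSqConvPow_succ_sub (n : ℕ) {a : ℝ} (ha : 1 / 2 < a) :
    logPotential (sechSqConvPow (n + 1)) (a + 1 / 2) -
      logPotential (sechSqConvPow (n + 1)) (a - 1 / 2) = cauchyPotential (sechSqConvPow n) a := by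
  refine logPotential_sub_eq_cauchyPotential (integrable_id_sechSqConvPow _) (fun t _ => ?_) ha
  rw [charFun_sechSqConvPow, charFun_sechSqConvPow, charFun_sechSqLaw_neg, pow_succ, mul_assoc,
    charFun_sechSqLaw_mul_sinh, mul_comm]

/-! ### Uniqueness for the difference equation and identification of both sides -/

lemma eq_zero_of_periodic_of_tendsto_zero {h : ℝ → ℂ} {c : ℝ} (hper : ∀ x, c < x → h (x + 1) = h x)
    (hlim : Tendsto h atTop (𝓝 0)) {x : ℝ} (hx : c < x) : h x = 0 := by
  have hk : ∀ k : ℕ, h (x + k) = h x := by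
    intro k
    induction k with
    | zero => simp
    | succ k ih =>
      rw [Nat.cast_succ, ← add_assoc, hper _ (by linarith [(k.cast_nonneg : (0 : ℝ) ≤ k)]), ih]
  have h1 : Tendsto (fun k : ℕ => h (x + k)) atTop (𝓝 0) :=
    hlim.comp (tendsto_atTop_add_const_left _ x tendsto_natCast_atTop_atTop)
  simp only [hk] at h1
  exact tendsto_nhds_unique tendsto_const_nhds h1

lemma tendsto_sub_const_atTop (c : ℝ) : Tendsto (fun x : ℝ => x - c) atTop atTop :=
  tendsto_atTop_add_const_right _ (-c) tendsto_id

lemma tendsto_logPotential_sub_const_sub_log {μ : Measure ℝ} [IsProbabilityMeasure μ]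
    (hμ : Integrable (fun s : ℝ => s) μ) (c : ℝ) :
    Tendsto (fun x : ℝ => logPotential μ (x - c) - Complex.log (x : ℂ)) atTop (𝓝 0) := by
  have h1 := (tendsto_logPotential_sub_log hμ).comp (tendsto_sub_const_atTop c)
  have h2 := (Complex.continuous_ofReal.tendsto 0).comp (Real.tendsto_log_comp_add_sub_log (-c))
  have h3 := h1.add h2
  rw [Complex.ofReal_zero, add_zero] at h3
  refine h3.congr' ?_
  filter_upwards [eventually_gt_atTop 0, eventually_gt_atTop c] with x hx hxc
  simp only [Function.comp_apply]
  rw [← Complex.ofReal_log hx.le, ← Complex.ofReal_log (by linarith : 0 ≤ x - c), ← sub_eq_add_neg]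
  push_cast
  ring

lemma cauchyPotential_sechSqConvPow_zero (a : ℝ) :
    cauchyPotential (sechSqConvPow 0) a = (a : ℂ)⁻¹ := by
  simp [cauchyPotential, sechSqConvPow]

lemma logPotential_sechSqConvPow_one {x : ℝ} (hx : 1 / 2 < x) :
    logPotential (sechSqConvPow 1) (x - 1 / 2) = Complex.digamma (x : ℂ) := by
  rw [← sub_eq_zero]
  refine eq_zero_of_periodic_of_tendsto_zero (c := 1 / 2)
    (h := fun x => logPotential (sechSqConvPow 1) (x - 1 / 2) - Complex.digamma (x : ℂ))
    (fun x hx => ?_) ?_ hx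
  · have h := logPotential_sechSqConvPow_succ_sub 0 hx
    rw [cauchyPotential_sechSqConvPow_zero, zero_add] at h
    rw [Complex.ofReal_add, Complex.ofReal_one, Complex.digamma_apply_add_one _
      (Complex.ofReal_ne_neg_natCast (by linarith)), ← h,
      show x + 1 - 1 / 2 = x + 1 / 2 by ring]
    ring
  · have h := (tendsto_logPotential_sub_const_sub_log (integrable_id_sechSqConvPow 1)
      (1 / 2)).sub tendsto_digamma_sub_log
    rw [sub_zero] at h
    exact h.congr fun x => by ring

/-- Induction on `n`: the formula at level `n` identifies the derivatives, hence the unit increments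
of both sides at level `n + 1`; equality then follows from the limit at infinity. -/
theorem logPotential_sechSqConvPow_succ (n : ℕ) {x : ℝ} (hx : ((n + 1 : ℕ) : ℝ) / 2 < x) :
    logPotential (sechSqConvPow (n + 1)) (x - ((n + 1 : ℕ) : ℝ) / 2) = digammaCore n x := by
  induction n generalizing x with
  | zero =>
    simp only [zero_add, Nat.cast_one] at hx ⊢
    rw [logPotential_sechSqConvPow_one hx, digammaCore_zero]
  | succ n ih =>
    set c : ℝ := ((n + 1 : ℕ) : ℝ) / 2 with hc
    have hc0 : 0 < c := by positivity
    have hc1 : ((n + 1 + 1 : ℕ) : ℝ) / 2 = c + 1 / 2 := by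
      rw [hc]
      push_cast
      ring
    rw [hc1] at hx ⊢
    have hderiv : ∀ y, c < y →
        deriv (digammaCore n) y = cauchyPotential (sechSqConvPow (n + 1)) (y - c) := by
      intro y hy
      have hev : digammaCore n =ᶠ[𝓝 y] fun y => logPotential (sechSqConvPow (n + 1)) (y - c) := by
        filter_upwards [eventually_gt_nhds hy] with z hz using (ih hz).symm
      rw [hev.deriv_eq]
      exact ((hasDerivAt_logPotential (integrable_id_sechSqConvPow _)
        (sub_pos.2 hy)).comp_sub_const y c).deriv
    rw [← sub_eq_zero]
    refine eq_zero_of_periodic_of_tendsto_zero (c := c + 1 / 2)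
      (h := fun x => logPotential (sechSqConvPow (n + 1 + 1)) (x - (c + 1 / 2)) -
        digammaCore (n + 1) x) (fun y hy => ?_) ?_ hx
    · have h := logPotential_sechSqConvPow_succ_sub (n + 1) (a := y - c) (by linarith)
      rw [digammaCore_succ_add_one n (by linarith), hderiv y (by linarith), ← h,
        show y + 1 - (c + 1 / 2) = y - c + 1 / 2 by ring,
        show y - (c + 1 / 2) = y - c - 1 / 2 by ring]
      ring
    -- By `digammaCore_succ` the difference is that of two potentials, each `log y + o(1)`, minus
    -- `((y - (n+1)) U' - 1) / (n+1)`, where `U'` is the Cauchy potential at `y - c`. As `n + 1 =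
    -- 2c`, the factor `y - (n+1)` is `(y - c) - c`, so `(y - c) U' → 1` and `U' → 0` suffice.
    · have h1 := tendsto_logPotential_sub_const_sub_log
        (integrable_id_sechSqConvPow (n + 1 + 1)) (c + 1 / 2)
      have h2 := tendsto_logPotential_sub_const_sub_log (integrable_id_sechSqConvPow (n + 1)) c
      have h3 := (tendsto_mul_cauchyPotential (integrable_id_sechSqConvPow (n + 1))).comp
        (tendsto_sub_const_atTop c)
      have h4 := (tendsto_cauchyPotential (integrable_id_sechSqConvPow (n + 1))).comp
        (tendsto_sub_const_atTop c)
      have h5 := (h1.sub h2).sub ((((h3.sub (h4.const_mul (c : ℂ))).sub_const 1)).const_mul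
        ((n + 1 : ℂ)⁻¹))
      simp only [mul_zero, sub_zero, sub_self] at h5
      refine h5.congr' ?_
      filter_upwards [eventually_gt_atTop c] with y hy
      have hn : (n + 1 : ℂ) ≠ 0 := n.cast_add_one_ne_zero
      have hcn : (c : ℂ) = (n + 1) / 2 := by
        rw [hc]
        push_cast
        ring
      rw [digammaCore_succ n (by linarith), hderiv y hy, ← ih hy]
      simp only [Function.comp_apply, Complex.ofReal_sub, hcn]
      field_simp
      ring

lemma continuousAt_digammaCore (n : ℕ) {x : ℝ} (hx : 0 < x) : ContinuousAt (digammaCore n) x :=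
  (analyticAt_digammaCore n hx).continuousAt

/-- Both sides are continuous there, so the identity for larger arguments passes to the limit from
the right. -/
lemma digammaCore_half (n : ℕ) :
    digammaCore n (((n + 1 : ℕ) : ℝ) / 2) = logPotential (sechSqConvPow (n + 1)) 0 := by
  set c : ℝ := ((n + 1 : ℕ) : ℝ) / 2 with hc
  have hc0 : 0 < c := by positivity
  have h1 : Tendsto (digammaCore n) (𝓝[>] c) (𝓝 (digammaCore n c)) :=
    (continuousAt_digammaCore n hc0).tendsto.mono_left nhdsWithin_le_nhds
  have h2 : Tendsto (fun x => logPotential (sechSqConvPow (n + 1)) (x - c)) (𝓝[>] c)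
      (𝓝 (logPotential (sechSqConvPow (n + 1)) 0)) := by
    have hcont := continuousAt_logPotential_zero (sechSqConvPow_succ_le n)
      (integrable_id_sechSqConvPow (n + 1))
    have hsub : Tendsto (fun x : ℝ => x - c) (𝓝 c) (𝓝 0) := by
      have : ContinuousAt (fun x : ℝ => x - c) c := by fun_prop
      simpa [ContinuousAt] using this
    exact hcont.tendsto.comp (hsub.mono_left nhdsWithin_le_nhds)
  refine tendsto_nhds_unique h1 (h2.congr' ?_)
  filter_upwards [self_mem_nhdsWithin] with x hx
  exact logPotential_sechSqConvPow_succ n hx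

/-- Only finitely many points are excluded, so at most the centre itself is bad; for `c = ℓ/2` with
`ℓ` even it is, hence the punctured neighbourhood. -/
lemma eventually_digammaExpr_eq_digammaCore (n : ℕ) {c : ℝ} (hc : 0 < c) :
    digammaExpr (n + 1) =ᶠ[𝓝[≠] c] digammaCore n := by
  have h : ∀ᶠ x in 𝓝[≠] c, ∀ i ∈ Finset.range ((n + 1) / 2), x ≠ (i : ℝ) + 1 := by
    rw [Finset.eventually_all]
    intro i _
    rcases eq_or_ne c ((i : ℝ) + 1) with h | h
    · rw [← h]
      exact self_mem_nhdsWithin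
    · exact nhdsWithin_le_nhds (eventually_ne_nhds h)
  filter_upwards [h, nhdsWithin_le_nhds (eventually_gt_nhds hc)] with x hx hx0
  exact digammaExpr_eq_digammaCore hx0 fun i hi => hx i (Finset.mem_range.2 hi)

/-! ### From the random variables to their law, and the theorem -/

lemma map_sum_eq_sechSqConvPow {Ω : Type*} [MeasurableSpace Ω] {P : Measure Ω}
    [IsProbabilityMeasure P] {ℓ : ℕ} {L : Fin ℓ → Ω → ℝ}
    (hlaw : ∀ j, HasLaw (L j) sechSqLaw P) (hind : iIndepFun L P) :
    P.map (fun ω => ∑ j, L j ω) = sechSqConvPow ℓ := by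
  have hm : AEMeasurable (fun ω => ∑ j, L j ω) P :=
    Finset.aemeasurable_fun_sum _ fun j _ => (hlaw j).aemeasurable
  have : IsProbabilityMeasure (P.map (fun ω => ∑ j, L j ω)) :=
    Measure.isProbabilityMeasure_map hm
  refine Measure.ext_of_charFun ?_
  rw [hind.charFun_map_fun_sum_eq_prod fun j => (hlaw j).aemeasurable]
  ext t
  simp [(hlaw _).map_eq, charFun_sechSqConvPow]

theorem mainTheorem2 {Ω : Type*} [MeasurableSpace Ω] (P : Measure Ω) [IsProbabilityMeasure P]
    (ℓ : ℕ) (hℓ : 1 ≤ ℓ) (L : Fin ℓ → Ω → ℝ)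
    (hlaw : ∀ j, HasLaw (L j) sechSqLaw P) (hind : iIndepFun L P) :
    (∀ x : ℝ, Integrable (fun ω => Complex.log (norlundUmbra L x ω)) P) ∧
    (∀ x : ℝ, (ℓ : ℝ) / 2 < x ∨ (x = (ℓ : ℝ) / 2 ∧ Odd ℓ) →
      norlundEval P L Complex.log x = digammaExpr ℓ x) ∧
    Tendsto (digammaExpr ℓ) (𝓝[≠] ((ℓ : ℝ) / 2))
      (𝓝 (norlundEval P L Complex.log ((ℓ : ℝ) / 2))) ∧
    (∀ x : ℝ, x < (ℓ : ℝ) / 2 →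
      norlundEval P L Complex.log x = digammaExpr ℓ ((ℓ : ℝ) - x)) := by
  have hm : AEMeasurable (fun ω => ∑ j, L j ω) P :=
    Finset.aemeasurable_fun_sum _ fun j _ => (hlaw j).aemeasurable
  have hmap := map_sum_eq_sechSqConvPow hlaw hind
  have humbra : ∀ x ω, norlundUmbra L x ω =
      ((x - (ℓ : ℝ) / 2 : ℝ) : ℂ) + Complex.I * ((∑ j, L j ω : ℝ) : ℂ) := by
    intro x ω
    simp [norlundUmbra]
  have heval : ∀ x, norlundEval P L Complex.log x =
      logPotential (sechSqConvPow ℓ) (x - (ℓ : ℝ) / 2) := by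
    intro x
    simp only [norlundEval, humbra, logPotential, ← hmap]
    rw [integral_map hm (measurable_log_ofReal_add_I_mul _).aestronglyMeasurable]
  obtain ⟨n, rfl⟩ : ∃ n, ℓ = n + 1 := ⟨ℓ - 1, by omega⟩
  have hpos : (0 : ℝ) < ((n + 1 : ℕ) : ℝ) / 2 := by positivity
  have hgt : ∀ x : ℝ, ((n + 1 : ℕ) : ℝ) / 2 < x →
      logPotential (sechSqConvPow (n + 1)) (x - ((n + 1 : ℕ) : ℝ) / 2) =
        digammaExpr (n + 1) x := by
    intro x hx
    rw [logPotential_sechSqConvPow_succ n hx, digammaExpr_eq_digammaCore (hpos.trans hx)]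
    intro i hi h
    -- The excluded points are at most `⌊ℓ/2⌋ ≤ ℓ/2 < x`.
    have h1 : 2 * (i + 1) ≤ n + 1 := by omega
    have h2 : 2 * ((i : ℝ) + 1) ≤ ((n + 1 : ℕ) : ℝ) := by exact_mod_cast h1
    linarith
  refine ⟨fun x => ?_, fun x hx => ?_, ?_, fun x hx => ?_⟩
  · simp only [humbra]
    have h := integrable_log_ofReal_add_I_mul (sechSqConvPow_succ_le n)
      (integrable_id_sechSqConvPow (n + 1)) (x - ((n + 1 : ℕ) : ℝ) / 2)
    rw [← hmap] at h
    exact h.comp_aemeasurable hm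
  · rw [heval]
    rcases hx with hx | ⟨rfl, hodd⟩
    · exact hgt x hx
    · rw [sub_self, digammaExpr_eq_digammaCore hpos, digammaCore_half]
      intro i hi h
      -- For odd `ℓ`, `⌊ℓ/2⌋ < ℓ/2` strictly, so the endpoint itself is not excluded.
      have h1 : 2 * (i + 1) < n + 1 := by
        obtain ⟨k, hk⟩ := hodd
        omega
      have h2 : 2 * ((i : ℝ) + 1) < ((n + 1 : ℕ) : ℝ) := by exact_mod_cast h1
      linarith
  · rw [heval, sub_self, ← digammaCore_half]
    exact ((continuousAt_digammaCore n hpos).tendsto.mono_left nhdsWithin_le_nhds).congr'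
      (eventually_digammaExpr_eq_digammaCore n hpos).symm
  -- With `a = x - ℓ/2`, replacing `x` by `ℓ - x` is `a ↦ -a`.
  · rw [heval, ← logPotential_neg (sechSqConvPow_succ_le n) (integrable_id_sechSqConvPow (n + 1))
      (map_neg_sechSqConvPow (n + 1)), ← hgt _ (by linarith)]
    congr 1
    ring

end
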